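/- **Definitions.** All graphs are finite and simple; $x\simeq y$ means that the vertices $x,y$ are adjacent or equal. Let $\mathcal G$ be the semiring of isomorphism classes of graphs, with disjoint union as addition and strong product as multiplication, preordered by $H\le G$ iff there is a graph homomorphism $\overline H\to\overline G$ between the complements. A *noncommutative graph* is a subspace $S\subseteq B(\mathcal H)$ of the operators on a finite-dimensional complex Hilbert space with $I\in S$ and $S^*=S$; two of them are isomorphic if $USU^*=T$ for some unitary $U$. Let $\mathcal G_{\mathrm{nc}}$ be the semiring of isomorphism classes of noncommutative graphs, with direct sum $S\oplus T=\{A\oplus B: A\in S, B\in T\}$ and tensor product $S\otimes T=\operatorname{span}\{A\otimes B: A\in S, B\in T\}$, preordered as follows: for $T\subseteq B(\mathcal K)$ and $S\subseteq B(\mathcal H)$, $T\le S$ iff there are finitely many linear maps $E_i:\mathcal K\to\mathcal H$ with $\sum_i E_i^*E_i=I$ and $E_i^*SE_j\subseteq T$ for all $i,j$. A graph $G$ is regarded as the noncommutative graph $\mathcal S_G=\operatorname{span}\{|x\rangle\langle x'| : x\simeq x'\}\subseteq B(\mathbb C^{V(G)})$, which gives a semiring homomorphism $\mathcal G\to\mathcal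 G_{\mathrm{nc}}$. Let $\mathcal Q_d=\mathbb C I\subseteq B(\mathbb C^d)$ for $d\in\mathbb N$ (the confusability graph of the noiseless $d$-dimensional quantum channel). Let $\mathcal A\subseteq\mathcal G_{\mathrm{nc}}$ be the subsemiring generated by all $\mathcal S_G$ and all $\mathcal Q_d$, with the restricted preorder. For a preordered semiring $(R,\le)$, let $\Delta(R,\le)$ be the set of monotone semiring homomorphisms $R\to\mathbb R_{\ge0}$ (its asymptotic spectrum). For a graph parameter $f:\mathcal G\to\mathbb R$, a real number $\alpha\ge1$ is an *admissible exponent* if there is an $F\in\Delta(\mathcal A,\le)$ with $F\bigl(\bigoplus_{d=1}^r \mathcal S_{G_d}\otimes\mathcal Q_d\bigr)=\sum_{d=1}^r f(G_d)\,d^\alpha$ for all $r$ and all graphs $G_1,\dots,G_r$. The fractional clique cover number is $\overline{\chi_f}(G)=\chi_f(\overline G)$, where the fractional chromatic number $\chi_f(H)$ is the infimum of $\sum_I w(I)$ over nonnegative weights $w$ on the independent sets $I$ of $H$ such that $\sum_{I\ni v}w(I)\ge1$ for every vertex $v$. **Proposition.** The fractional clique cover number does not extend to an element of $\Delta(\mathcal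 A,\le)$: there is no $F\in\Delta(\mathcal A,\le)$ with $F(\mathcal S_G)=\overline{\chi_f}(G)$ for every graph $G$. In particular, no $\alpha\in[1,\infty)$ is an admissible exponent for $\overline{\chi_f}$. -/

import Mathlib

open scoped Matrix Kronecker NNReal

noncomputable section

/-! ## Finite graphs, strong product, cohomomorphisms -/

/-- A finite simple undirected graph. -/
structure FinGraph where
  V : Type
  [fintypeV : Fintype V]
  [decEqV : DecidableEq V]
  graph : SimpleGraph V

attribute [instance] FinGraph.fintypeV FinGraph.decEqV

/-- The relation "adjacent or equal". -/
def AdjEq {V : Type} (G : SimpleGraph V) (x y : V) : Prop := x = y ∨ G.Adj x y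

theorem AdjEq.symm {V : Type} {G : SimpleGraph V} {x y : V} (h : AdjEq G x y) : AdjEq G y x :=
  h.elim (fun h => Or.inl h.symm) (fun h => Or.inr h.symm)

theorem adjEq_refl {V : Type} (G : SimpleGraph V) (x : V) : AdjEq G x x := Or.inl rfl

theorem adj_iff_adjEq {V : Type} {G : SimpleGraph V} {x y : V} :
    G.Adj x y ↔ x ≠ y ∧ AdjEq G x y :=
  ⟨fun h => ⟨h.ne, Or.inr h⟩, fun h => h.2.resolve_left h.1⟩

theorem adjEq_iso {V W : Type} {G : SimpleGraph V} {H : SimpleGraph W} (e : G ≃g H) {x y : V} :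
    AdjEq H (e x) (e y) ↔ AdjEq G x y := by
  rw [AdjEq, AdjEq, e.apply_eq_iff_eq, e.map_adj_iff]

/-- A bijection preserving "adjacent or equal" is a graph isomorphism. -/
def isoOfAdjEq {V W : Type} {G : SimpleGraph V} {H : SimpleGraph W} (e : V ≃ W)
    (h : ∀ x y, AdjEq H (e x) (e y) ↔ AdjEq G x y) : G ≃g H where
  toEquiv := e
  map_rel_iff' := by
    intro x y
    rw [adj_iff_adjEq, adj_iff_adjEq, h, Ne, e.apply_eq_iff_eq]

/-- The strong product of two graphs. -/
def strongProd {V W : Type} (G : SimpleGraph V) (H : SimpleGraph W) : SimpleGraph (V × W) where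
  Adj p q := p ≠ q ∧ AdjEq G p.1 q.1 ∧ AdjEq H p.2 q.2
  symm := ⟨fun _ _ h => ⟨h.1.symm, h.2.1.symm, h.2.2.symm⟩⟩
  loopless := ⟨fun _ h => h.1 rfl⟩

theorem adjEq_strongProd {V W : Type} {G : SimpleGraph V} {H : SimpleGraph W} {p q : V × W} :
    AdjEq (strongProd G H) p q ↔ AdjEq G p.1 q.1 ∧ AdjEq H p.2 q.2 := by
  by_cases h : p = q
  · subst h; simp [adjEq_refl]
  · simp [AdjEq, strongProd, h]

theorem adjEq_sum_inl {V W : Type} {G : SimpleGraph V} {H : SimpleGraph W} {x y : V} :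
    AdjEq (G ⊕g H) (.inl x) (.inl y) ↔ AdjEq G x y := by simp [AdjEq]

theorem adjEq_sum_inr {V W : Type} {G : SimpleGraph V} {H : SimpleGraph W} {x y : W} :
    AdjEq (G ⊕g H) (.inr x) (.inr y) ↔ AdjEq H x y := by simp [AdjEq]

theorem adjEq_sum_inl_inr {V W : Type} {G : SimpleGraph V} {H : SimpleGraph W} {x : V} {y : W} :
    AdjEq (G ⊕g H) (.inl x) (.inr y) ↔ False := by simp [AdjEq]

theorem adjEq_sum_inr_inl {V W : Type} {G : SimpleGraph V} {H : SimpleGraph W} {x : W} {y : V} :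
    AdjEq (G ⊕g H) (.inr x) (.inl y) ↔ False := by simp [AdjEq]

/-- Isomorphic graphs have isomorphic complements. -/
def complIso {V W : Type} {G : SimpleGraph V} {H : SimpleGraph W} (e : G ≃g H) : Gᶜ ≃g Hᶜ where
  toEquiv := e.toEquiv
  map_rel_iff' := by
    intro a b
    have h : H.Adj (e.toEquiv a) (e.toEquiv b) ↔ G.Adj a b := e.map_adj_iff
    rw [SimpleGraph.compl_adj, SimpleGraph.compl_adj, h, Ne, e.toEquiv.apply_eq_iff_eq]

def strongOneIso {V : Type} (G : SimpleGraph V) : strongProd (⊥ : SimpleGraph Unit) G ≃g G :=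
  isoOfAdjEq (Equiv.punitProd V) (by
    rintro ⟨⟨⟩, x⟩ ⟨⟨⟩, y⟩
    simp [adjEq_strongProd, adjEq_refl, Equiv.punitProd])

def strongEmptyIso {V : Type} (G : SimpleGraph V) :
    strongProd (⊥ : SimpleGraph Empty) G ≃g (⊥ : SimpleGraph Empty) :=
  isoOfAdjEq (Equiv.equivOfIsEmpty _ _) (fun x => x.1.elim)

def strongSumIso {V W X : Type} (G : SimpleGraph V) (H : SimpleGraph W) (K : SimpleGraph X) :
    strongProd G (H ⊕g K) ≃g strongProd G H ⊕g strongProd G K :=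
  isoOfAdjEq (Equiv.prodSumDistrib V W X) (by
    rintro ⟨x, (x' | x')⟩ ⟨y, (y' | y')⟩ <;>
    simp [adjEq_strongProd, adjEq_sum_inl, adjEq_sum_inr, adjEq_sum_inl_inr, adjEq_sum_inr_inl,
      Equiv.prodSumDistrib, Equiv.sumProdDistrib])

namespace FinGraph

/-- Graph isomorphism. -/
def Iso (G H : FinGraph) : Prop := Nonempty (G.graph ≃g H.graph)

instance setoid : Setoid FinGraph where
  r := Iso
  iseqv := ⟨fun _ => ⟨RelIso.refl _⟩, fun ⟨e⟩ => ⟨e.symm⟩, fun ⟨e⟩ ⟨f⟩ => ⟨e.trans f⟩⟩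

/-- Disjoint union. -/
def disjUnion (G H : FinGraph) : FinGraph := ⟨G.V ⊕ H.V, G.graph ⊕g H.graph⟩

/-- Strong product. -/
def strong (G H : FinGraph) : FinGraph := ⟨G.V × H.V, strongProd G.graph H.graph⟩

/-- The graph without vertices. -/
def empty : FinGraph := ⟨Empty, ⊥⟩

/-- The graph with a single vertex. -/
def single : FinGraph := ⟨Unit, ⊥⟩

/-- `G.Cohom H` (written `G ≤ H` on isomorphism classes): there is a cohomomorphism from `G` to `H`,
that is, a homomorphism between the complements. -/
def Cohom (G H : FinGraph) : Prop := Nonempty (G.graphᶜ →g H.graphᶜ)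

theorem Cohom.trans {G H K : FinGraph} : G.Cohom H → H.Cohom K → G.Cohom K :=
  fun ⟨e⟩ ⟨f⟩ => ⟨f.comp e⟩

theorem Iso.cohom {G H : FinGraph} : G.Iso H → G.Cohom H := by
  rintro ⟨e⟩
  exact ⟨(complIso e).toHom⟩

theorem iso_disjUnion {G G' H H' : FinGraph} :
    G.Iso G' → H.Iso H' → (disjUnion G H).Iso (disjUnion G' H') := by
  rintro ⟨e⟩ ⟨f⟩
  refine ⟨isoOfAdjEq (Equiv.sumCongr e.toEquiv f.toEquiv) ?_⟩
  rintro (x | x) (y | y)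
  · exact adjEq_sum_inl.trans ((adjEq_iso e).trans adjEq_sum_inl.symm)
  · exact adjEq_sum_inl_inr.trans adjEq_sum_inl_inr.symm
  · exact adjEq_sum_inr_inl.trans adjEq_sum_inr_inl.symm
  · exact adjEq_sum_inr.trans ((adjEq_iso f).trans adjEq_sum_inr.symm)

theorem iso_strong {G G' H H' : FinGraph} :
    G.Iso G' → H.Iso H' → (strong G H).Iso (strong G' H') := by
  rintro ⟨e⟩ ⟨f⟩
  refine ⟨isoOfAdjEq (Equiv.prodCongr e.toEquiv f.toEquiv) ?_⟩
  intro x y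
  exact adjEq_strongProd.trans ((and_congr (adjEq_iso e) (adjEq_iso f)).trans adjEq_strongProd.symm)

end FinGraph

/-- The set `𝒢` of isomorphism classes of finite graphs. -/
def GraphClass : Type 1 := Quotient FinGraph.setoid

namespace GraphClass

instance : Zero GraphClass := ⟨Quotient.mk _ FinGraph.empty⟩
instance : One GraphClass := ⟨Quotient.mk _ FinGraph.single⟩
instance : Add GraphClass :=
  ⟨Quotient.map₂ FinGraph.disjUnion fun _ _ h _ _ h' => FinGraph.iso_disjUnion h h'⟩
instance : Mul GraphClass :=
  ⟨Quotient.map₂ FinGraph.strong fun _ _ h _ _ h' => FinGraph.iso_strong h h'⟩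

protected theorem add_comm' (a b : GraphClass) : a + b = b + a := by
  induction a using Quotient.inductionOn with | _ G
  induction b using Quotient.inductionOn with | _ H
  exact Quotient.sound ⟨SimpleGraph.Iso.sumComm⟩

protected theorem zero_add' (a : GraphClass) : 0 + a = a := by
  induction a using Quotient.inductionOn with | _ G
  refine Quotient.sound ⟨isoOfAdjEq (Equiv.emptySum Empty G.V) ?_⟩
  rintro (x | x) (y | y)
  · exact x.elim
  · exact x.elim
  · exact y.elim
  · exact adjEq_sum_inr.symm

protected theorem mul_comm' (a b : GraphClass) : a * b = b * a := by
  induction a using Quotient.inductionOn with | _ G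
  induction b using Quotient.inductionOn with | _ H
  refine Quotient.sound ⟨isoOfAdjEq (Equiv.prodComm G.V H.V) ?_⟩
  intro x y
  exact adjEq_strongProd.trans (and_comm.trans adjEq_strongProd.symm)

protected theorem one_mul' (a : GraphClass) : 1 * a = a := by
  induction a using Quotient.inductionOn with | _ G
  exact Quotient.sound ⟨strongOneIso G.graph⟩

protected theorem zero_mul' (a : GraphClass) : 0 * a = 0 := by
  induction a using Quotient.inductionOn with | _ G
  exact Quotient.sound ⟨strongEmptyIso G.graph⟩

protected theorem left_distrib' (a b c : GraphClass) : a * (b + c) = a * b + a * c := by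
  induction a using Quotient.inductionOn with | _ G
  induction b using Quotient.inductionOn with | _ H
  induction c using Quotient.inductionOn with | _ K
  exact Quotient.sound ⟨strongSumIso G.graph H.graph K.graph⟩

/-- The semiring of graphs: disjoint union as addition, strong product as multiplication. -/
instance : CommSemiring GraphClass where
  add_assoc a b c := by
    induction a using Quotient.inductionOn with | _ G
    induction b using Quotient.inductionOn with | _ H
    induction c using Quotient.inductionOn with | _ K
    exact Quotient.sound ⟨SimpleGraph.Iso.sumAssoc⟩
  zero_add := GraphClass.zero_add'
  add_zero a := (GraphClass.add_comm' a 0).trans (GraphClass.zero_add' a)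
  add_comm := GraphClass.add_comm'
  nsmul := nsmulRec
  mul_assoc a b c := by
    induction a using Quotient.inductionOn with | _ G
    induction b using Quotient.inductionOn with | _ H
    induction c using Quotient.inductionOn with | _ K
    refine Quotient.sound ⟨isoOfAdjEq (Equiv.prodAssoc G.V H.V K.V) ?_⟩
    intro x y
    refine adjEq_strongProd.trans ((and_congr_right' adjEq_strongProd).trans
      (and_assoc.symm.trans ?_))
    exact (and_congr_left' adjEq_strongProd.symm).trans adjEq_strongProd.symm
  one_mul := GraphClass.one_mul'
  mul_one a := (GraphClass.mul_comm' a 1).trans (GraphClass.one_mul' a)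
  left_distrib := GraphClass.left_distrib'
  right_distrib a b c := by
    rw [GraphClass.mul_comm', GraphClass.left_distrib', GraphClass.mul_comm' c a,
      GraphClass.mul_comm' c b]
  zero_mul := GraphClass.zero_mul'
  mul_zero a := (GraphClass.mul_comm' a 0).trans (GraphClass.zero_mul' a)
  mul_comm := GraphClass.mul_comm'

/-- The cohomomorphism preorder on graphs. -/
instance : Preorder GraphClass where
  le := Quotient.lift₂ FinGraph.Cohom fun _ _ _ _ h h' => propext
    ⟨fun k => (FinGraph.Iso.cohom (Setoid.symm h)).trans (k.trans (FinGraph.Iso.cohom h')),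
      fun k => (FinGraph.Iso.cohom h).trans (k.trans (FinGraph.Iso.cohom (Setoid.symm h')))⟩
  le_refl a := by
    induction a using Quotient.inductionOn with | _ G
    exact FinGraph.Iso.cohom (Setoid.refl G)
  le_trans a b c := by
    induction a using Quotient.inductionOn with | _ G
    induction b using Quotient.inductionOn with | _ H
    induction c using Quotient.inductionOn with | _ K
    exact FinGraph.Cohom.trans

end GraphClass

/-! ## The fractional clique cover number -/

/-- The values `∑ w(I)` of fractional colourings `w` of `G`: nonnegative weights on the independent
sets such that every vertex is covered with total weight at least `1`. -/
def fractionalColoringValues {V : Type} [Fintype V] [DecidableEq V] (G : SimpleGraph V) : Set ℝ :=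
  {t | ∃ w : Finset V → ℝ, (∀ I, 0 ≤ w I) ∧ (∀ I, w I ≠ 0 → G.IsIndepSet (I : Set V)) ∧
    (∀ v, 1 ≤ ∑ I : Finset V, if v ∈ I then w I else 0) ∧ t = ∑ I : Finset V, w I}

/-- The fractional chromatic number `χ_f`. -/
def fractionalChromaticNumber {V : Type} [Fintype V] [DecidableEq V] (G : SimpleGraph V) : ℝ :=
  sInf (fractionalColoringValues G)

theorem fractionalColoringValues_subset_of_iso {V W : Type} [Fintype V] [DecidableEq V] [Fintype W]
    [DecidableEq W] {G : SimpleGraph V} {H : SimpleGraph W} (e : G ≃g H) :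
    fractionalColoringValues G ⊆ fractionalColoringValues H := by
  rintro t ⟨w, h0, h1, h2, rfl⟩
  refine ⟨fun I => w (I.map e.symm.toEquiv.toEmbedding), fun I => h0 _, ?_, ?_, ?_⟩
  · intro I hI x hx y hy hxy hadj
    have := h1 _ hI (x := e.symm x) (by simpa using hx) (y := e.symm y) (by simpa using hy)
      (by simpa using hxy)
    exact this (e.symm.map_adj_iff.2 hadj)
  · intro v
    refine (h2 (e.symm v)).trans (le_of_eq ?_)
    refine (Equiv.sum_comp (Equiv.finsetCongr e.symm.toEquiv) _).symm.trans ?_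
    refine Finset.sum_congr rfl fun I _ => ?_
    have : e.symm v ∈ I.map e.symm.toEquiv.toEmbedding ↔ v ∈ I := by
      simp [RelIso.symm]
    simp only [Equiv.finsetCongr_apply, this]
  · exact (Equiv.sum_comp (Equiv.finsetCongr e.symm.toEquiv) _).symm

/-- The fractional clique cover number: the fractional chromatic number of the complement. -/
def fractionalCliqueCover : GraphClass → ℝ :=
  Quotient.lift (fun G => fractionalChromaticNumber G.graphᶜ) fun _ _ h => by
    obtain ⟨e⟩ := h
    exact congrArg sInf (Set.Subset.antisymm
      (fractionalColoringValues_subset_of_iso (complIso e))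
      (fractionalColoringValues_subset_of_iso (complIso e).symm))

/-! ## Operator spaces: direct sums, tensor products, isomorphisms, cohomomorphisms

Operators on the Hilbert space `ℂ^V` are written as matrices indexed by `V`; every finite
dimensional Hilbert space is of this form up to a unitary. -/

/-- A space of operators on `ℂ^V`. -/
abbrev OpSpace (V : Type) := Submodule ℂ (Matrix V V ℂ)

/-- `S ⊕ T = {A ⊕ B | A ∈ S, B ∈ T}`. -/
def sumSpace {V W : Type} (S : OpSpace V) (T : OpSpace W) : OpSpace (V ⊕ W) where
  carrier := {M | ∃ A ∈ S, ∃ B ∈ T, M = Matrix.fromBlocks A 0 0 B}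
  zero_mem' := ⟨0, S.zero_mem, 0, T.zero_mem, by simp⟩
  add_mem' := by
    rintro _ _ ⟨A, hA, B, hB, rfl⟩ ⟨A', hA', B', hB', rfl⟩
    exact ⟨A + A', S.add_mem hA hA', B + B', T.add_mem hB hB', by simp [Matrix.fromBlocks_add]⟩
  smul_mem' := by
    rintro c _ ⟨A, hA, B, hB, rfl⟩
    exact ⟨c • A, S.smul_mem c hA, c • B, T.smul_mem c hB, by simp [Matrix.fromBlocks_smul]⟩

/-- `S ⊗ T = span {A ⊗ B | A ∈ S, B ∈ T}`. -/
def tensorSpace {V W : Type} (S : OpSpace V) (T : OpSpace W) : OpSpace (V × W) :=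
  Submodule.span ℂ {M | ∃ A ∈ S, ∃ B ∈ T, M = A ⊗ₖ B}

/-- `span {|x⟩⟨y| : x ≃ y}`. -/
def graphSpace {V : Type} [DecidableEq V] (G : SimpleGraph V) : OpSpace V :=
  Submodule.span ℂ {M | ∃ x y, AdjEq G x y ∧ M = Matrix.single x y 1}

/-- There is a unitary `U : ℂ^V → ℂ^W` with `U S U* = T`. -/
def SpaceIso {V W : Type} [Fintype V] [DecidableEq V] [Fintype W] [DecidableEq W]
    (S : OpSpace V) (T : OpSpace W) : Prop :=
  ∃ U : Matrix W V ℂ, Uᴴ * U = 1 ∧ U * Uᴴ = 1 ∧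
    (fun A : Matrix V V ℂ => U * A * Uᴴ) '' (S : Set (Matrix V V ℂ)) = (T : Set (Matrix W W ℂ))

/-- `SpaceCohom T S` (written `T ≤ S` on isomorphism classes): there are linear maps
`E i : ℂ^V → ℂ^W` with `∑ E i* E i = 1` and `E i* S E j ⊆ T`. -/
def SpaceCohom {V W : Type} [Fintype V] [DecidableEq V] [Fintype W] [DecidableEq W]
    (T : OpSpace V) (S : OpSpace W) : Prop :=
  ∃ (ι : Type) (_ : Fintype ι) (E : ι → Matrix W V ℂ), ∑ i, (E i)ᴴ * E i = 1 ∧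
    ∀ i j, ∀ A ∈ S, (E i)ᴴ * A * E j ∈ T

section Spaces

variable {V W X Y : Type} [Fintype V] [DecidableEq V] [Fintype W] [DecidableEq W]
  [Fintype X] [DecidableEq X] [Fintype Y] [DecidableEq Y]

theorem SpaceIso.of {S : OpSpace V} {T : OpSpace W} (U : Matrix W V ℂ) (h1 : Uᴴ * U = 1)
    (h2 : U * Uᴴ = 1) (h3 : ∀ A ∈ S, U * A * Uᴴ ∈ T) (h4 : ∀ B ∈ T, Uᴴ * B * U ∈ S) :
    SpaceIso S T := by
  refine ⟨U, h1, h2, Set.Subset.antisymm ?_ ?_⟩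
  · rintro _ ⟨A, hA, rfl⟩
    exact h3 A hA
  · intro B hB
    refine ⟨_, h4 B hB, ?_⟩
    calc U * (Uᴴ * B * U) * Uᴴ = (U * Uᴴ) * B * (U * Uᴴ) := by simp only [Matrix.mul_assoc]
      _ = B := by rw [h2, Matrix.one_mul, Matrix.mul_one]

theorem SpaceIso.elim {S : OpSpace V} {T : OpSpace W} (h : SpaceIso S T) :
    ∃ U : Matrix W V ℂ, Uᴴ * U = 1 ∧ U * Uᴴ = 1 ∧ (∀ A ∈ S, U * A * Uᴴ ∈ T) ∧
      (∀ B ∈ T, Uᴴ * B * U ∈ S) := by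
  obtain ⟨U, h1, h2, h3⟩ := h
  refine ⟨U, h1, h2, fun A hA => ?_, fun B hB => ?_⟩
  · have : U * A * Uᴴ ∈ (T : Set (Matrix W W ℂ)) := h3 ▸ ⟨A, hA, rfl⟩
    exact this
  · have : B ∈ (T : Set (Matrix W W ℂ)) := hB
    rw [← h3] at this
    obtain ⟨A, hA, rfl⟩ := this
    have : Uᴴ * (U * A * Uᴴ) * U = A := by
      calc Uᴴ * (U * A * Uᴴ) * U = (Uᴴ * U) * A * (Uᴴ * U) := by simp only [Matrix.mul_assoc]
        _ = A := by rw [h1, Matrix.one_mul, Matrix.mul_one]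
    rw [this]
    exact hA

theorem SpaceIso.refl (S : OpSpace V) : SpaceIso S S :=
  SpaceIso.of 1 (by simp) (by simp) (by simp) (by simp)

theorem SpaceIso.symm {S : OpSpace V} {T : OpSpace W} (h : SpaceIso S T) : SpaceIso T S := by
  obtain ⟨U, h1, h2, h3, h4⟩ := h.elim
  exact SpaceIso.of Uᴴ (by simpa using h2) (by simpa using h1) (by simpa using h4)
    (by simpa using h3)

theorem SpaceIso.trans {S : OpSpace V} {T : OpSpace W} {R : OpSpace X} (h : SpaceIso S T)
    (k : SpaceIso T R) : SpaceIso S R := by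
  obtain ⟨U, h1, h2, h3, h4⟩ := h.elim
  obtain ⟨U', k1, k2, k3, k4⟩ := k.elim
  refine SpaceIso.of (U' * U) ?_ ?_ (fun A hA => ?_) (fun B hB => ?_)
  · calc (U' * U)ᴴ * (U' * U) = Uᴴ * (U'ᴴ * U') * U := by
          simp only [Matrix.conjTranspose_mul, Matrix.mul_assoc]
      _ = 1 := by rw [k1, Matrix.mul_one, h1]
  · calc (U' * U) * (U' * U)ᴴ = U' * (U * Uᴴ) * U'ᴴ := by
          simp only [Matrix.conjTranspose_mul, Matrix.mul_assoc]
      _ = 1 := by rw [h2, Matrix.mul_one, k2]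
  · simpa only [Matrix.conjTranspose_mul, Matrix.mul_assoc] using k3 _ (h3 A hA)
  · simpa only [Matrix.conjTranspose_mul, Matrix.mul_assoc] using h4 _ (k4 B hB)

theorem SpaceIso.of_equiv {S : OpSpace V} {T : OpSpace W} (e : V ≃ W)
    (h : ∀ A ∈ S, A.submatrix e.symm e.symm ∈ T) (h' : ∀ B ∈ T, B.submatrix e e ∈ S) :
    SpaceIso S T := by
  have key : ∀ A : Matrix V V ℂ, (1 : Matrix V V ℂ).submatrix e.symm id * A *
      ((1 : Matrix V V ℂ).submatrix e.symm id)ᴴ = A.submatrix e.symm e.symm := by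
    intro A
    ext x y
    simp [Matrix.mul_apply, Matrix.one_apply]
  have key' : ∀ B : Matrix W W ℂ, ((1 : Matrix V V ℂ).submatrix e.symm id)ᴴ * B *
      ((1 : Matrix V V ℂ).submatrix e.symm id) = B.submatrix e e := by
    intro A
    ext x y
    simp [Matrix.mul_apply, Matrix.one_apply, Equiv.eq_symm_apply, Equiv.symm_apply_eq]
  refine SpaceIso.of ((1 : Matrix V V ℂ).submatrix e.symm id) ?_ ?_ (fun A hA => ?_)
    (fun B hB => ?_)
  · simp
  · have := key 1
    rw [Matrix.mul_one] at this
    rw [this]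
    simp
  · simpa only [key] using h A hA
  · simpa only [key'] using h' B hB

theorem SpaceCohom.trans {R : OpSpace V} {S : OpSpace W} {T : OpSpace X} (h : SpaceCohom R S)
    (k : SpaceCohom S T) : SpaceCohom R T := by
  obtain ⟨ι, _, E, h1, h2⟩ := h
  obtain ⟨κ, _, F, k1, k2⟩ := k
  refine ⟨ι × κ, inferInstance, fun p => F p.2 * E p.1, ?_, ?_⟩
  · rw [Fintype.sum_prod_type, ← h1]
    refine Finset.sum_congr rfl fun i _ => ?_
    calc ∑ j, (F j * E i)ᴴ * (F j * E i) = (E i)ᴴ * (∑ j, (F j)ᴴ * F j) * E i := by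
          simp only [Matrix.conjTranspose_mul, Matrix.mul_assoc, Matrix.mul_sum, Matrix.sum_mul]
      _ = (E i)ᴴ * E i := by rw [k1, Matrix.mul_one]
  · rintro ⟨i, i'⟩ ⟨j, j'⟩ A hA
    simpa only [Matrix.conjTranspose_mul, Matrix.mul_assoc] using h2 i j _ (k2 i' j' A hA)

theorem SpaceIso.cohom {S : OpSpace V} {T : OpSpace W} (h : SpaceIso S T) : SpaceCohom S T := by
  obtain ⟨U, h1, h2, h3, h4⟩ := h.elim
  exact ⟨Unit, inferInstance, fun _ => U, by simpa using h1, fun _ _ A hA => h4 A hA⟩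

theorem kron_mem {V' W' : Type} {S : OpSpace V'} {T : OpSpace W'} {A : Matrix V' V' ℂ}
    {B : Matrix W' W' ℂ} (hA : A ∈ S) (hB : B ∈ T) : A ⊗ₖ B ∈ tensorSpace S T :=
  Submodule.subset_span ⟨A, hA, B, hB, rfl⟩

/-- A linear map that sends all `A ⊗ B` into `R` sends `S ⊗ T` into `R`. -/
theorem tensorSpace_induction {V' W' X' : Type} {S : OpSpace V'} {T : OpSpace W'} {R : OpSpace X'}
    (L : Matrix (V' × W') (V' × W') ℂ →ₗ[ℂ] Matrix X' X' ℂ)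
    (h : ∀ A ∈ S, ∀ B ∈ T, L (A ⊗ₖ B) ∈ R) :
    ∀ M ∈ tensorSpace S T, L M ∈ R := by
  have : tensorSpace S T ≤ R.comap L := by
    refine Submodule.span_le.2 ?_
    rintro _ ⟨A, hA, B, hB, rfl⟩
    exact h A hA B hB
  exact fun M hM => this hM

/-- `M ↦ U M U'` as a linear map. -/
def sandwich {V' W' : Type} [Fintype V'] (U : Matrix W' V' ℂ) (U' : Matrix V' W' ℂ) :
    Matrix V' V' ℂ →ₗ[ℂ] Matrix W' W' ℂ where
  toFun M := U * M * U'
  map_add' A B := by rw [Matrix.mul_add, Matrix.add_mul]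
  map_smul' c A := by simp

/-- `M ↦ M ⊗ C` as a linear map. -/
def kronRight {V' W' : Type} (C : Matrix W' W' ℂ) :
    Matrix V' V' ℂ →ₗ[ℂ] Matrix (V' × W') (V' × W') ℂ where
  toFun M := M ⊗ₖ C
  map_add' A B := Matrix.add_kronecker A B C
  map_smul' c A := Matrix.smul_kronecker c A C

/-- `M ↦ C ⊗ M` as a linear map. -/
def kronLeft {V' W' : Type} (C : Matrix V' V' ℂ) :
    Matrix W' W' ℂ →ₗ[ℂ] Matrix (V' × W') (V' × W') ℂ where
  toFun M := C ⊗ₖ M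
  map_add' A B := Matrix.kronecker_add C A B
  map_smul' c A := Matrix.kronecker_smul c C A

/-- Reindexing as a linear map. -/
def reindexMap {V' W' : Type} (e : W' → V') : Matrix V' V' ℂ →ₗ[ℂ] Matrix W' W' ℂ where
  toFun M := M.submatrix e e
  map_add' _ _ := rfl
  map_smul' _ _ := rfl

theorem SpaceIso.sum {S : OpSpace V} {S' : OpSpace W} {T : OpSpace X} {T' : OpSpace Y}
    (h : SpaceIso S S') (k : SpaceIso T T') : SpaceIso (sumSpace S T) (sumSpace S' T') := by
  obtain ⟨U, h1, h2, h3, h4⟩ := h.elim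
  obtain ⟨U', k1, k2, k3, k4⟩ := k.elim
  refine SpaceIso.of (Matrix.fromBlocks U 0 0 U') ?_ ?_ ?_ ?_
  · simp [Matrix.fromBlocks_conjTranspose, Matrix.fromBlocks_multiply, h1, k1]
  · simp [Matrix.fromBlocks_conjTranspose, Matrix.fromBlocks_multiply, h2, k2]
  · rintro _ ⟨A, hA, B, hB, rfl⟩
    exact ⟨_, h3 A hA, _, k3 B hB, by
      simp [Matrix.fromBlocks_conjTranspose, Matrix.fromBlocks_multiply]⟩
  · rintro _ ⟨A, hA, B, hB, rfl⟩
    exact ⟨_, h4 A hA, _, k4 B hB, by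
      simp [Matrix.fromBlocks_conjTranspose, Matrix.fromBlocks_multiply]⟩

theorem SpaceIso.tensor {S : OpSpace V} {S' : OpSpace W} {T : OpSpace X} {T' : OpSpace Y}
    (h : SpaceIso S S') (k : SpaceIso T T') :
    SpaceIso (tensorSpace S T) (tensorSpace S' T') := by
  obtain ⟨U, h1, h2, h3, h4⟩ := h.elim
  obtain ⟨U', k1, k2, k3, k4⟩ := k.elim
  refine SpaceIso.of (U ⊗ₖ U') ?_ ?_ ?_ ?_
  · rw [Matrix.conjTranspose_kronecker, ← Matrix.mul_kronecker_mul, h1, k1, Matrix.one_kronecker_one]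
  · rw [Matrix.conjTranspose_kronecker, ← Matrix.mul_kronecker_mul, h2, k2, Matrix.one_kronecker_one]
  · refine tensorSpace_induction (sandwich (U ⊗ₖ U') (U ⊗ₖ U')ᴴ) fun A hA B hB => ?_
    have := kron_mem (h3 A hA) (k3 B hB)
    rwa [Matrix.mul_kronecker_mul, Matrix.mul_kronecker_mul,
      ← Matrix.conjTranspose_kronecker] at this
  · refine tensorSpace_induction (sandwich (U ⊗ₖ U')ᴴ (U ⊗ₖ U')) fun A hA B hB => ?_
    have := kron_mem (h4 A hA) (k4 B hB)
    rwa [Matrix.mul_kronecker_mul, Matrix.mul_kronecker_mul,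
      ← Matrix.conjTranspose_kronecker] at this

theorem spaceIso_sum_comm (S : OpSpace V) (T : OpSpace W) :
    SpaceIso (sumSpace S T) (sumSpace T S) := by
  refine SpaceIso.of_equiv (Equiv.sumComm V W) ?_ ?_ <;> rintro _ ⟨A, hA, B, hB, rfl⟩ <;>
    refine ⟨B, hB, A, hA, ?_⟩ <;> ext (x | x) (y | y) <;> simp

theorem spaceIso_sum_assoc (S : OpSpace V) (T : OpSpace W) (R : OpSpace X) :
    SpaceIso (sumSpace (sumSpace S T) R) (sumSpace S (sumSpace T R)) := by
  refine SpaceIso.of_equiv (Equiv.sumAssoc V W X) ?_ ?_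
  · rintro _ ⟨_, ⟨A, hA, B, hB, rfl⟩, C, hC, rfl⟩
    refine ⟨A, hA, _, ⟨B, hB, C, hC, rfl⟩, ?_⟩
    ext (x | x | x) (y | y | y) <;> simp
  · rintro _ ⟨A, hA, _, ⟨B, hB, C, hC, rfl⟩, rfl⟩
    refine ⟨_, ⟨A, hA, B, hB, rfl⟩, C, hC, ?_⟩
    ext ((x | x) | x) ((y | y) | y) <;> simp

theorem spaceIso_zero_sum (Z : OpSpace Empty) (S : OpSpace V) : SpaceIso (sumSpace Z S) S := by
  refine SpaceIso.of_equiv (Equiv.emptySum Empty V) ?_ ?_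
  · rintro _ ⟨A, hA, B, hB, rfl⟩
    convert hB using 1
    ext x y
    simp [Equiv.emptySum]
  · intro B hB
    refine ⟨0, Z.zero_mem, B, hB, ?_⟩
    ext (x | x) (y | y)
    · exact x.elim
    · exact x.elim
    · exact y.elim
    · simp [Equiv.emptySum]

theorem spaceIso_tensor_comm (S : OpSpace V) (T : OpSpace W) :
    SpaceIso (tensorSpace S T) (tensorSpace T S) := by
  refine SpaceIso.of_equiv (Equiv.prodComm V W) ?_ ?_
  · refine tensorSpace_induction (reindexMap (Equiv.prodComm V W).symm) fun A hA B hB => ?_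
    convert kron_mem hB hA using 1
    ext x y
    exact mul_comm _ _
  · refine tensorSpace_induction (reindexMap (Equiv.prodComm V W)) fun A hA B hB => ?_
    convert kron_mem hB hA using 1
    ext x y
    exact mul_comm _ _

theorem spaceIso_tensor_assoc (S : OpSpace V) (T : OpSpace W) (R : OpSpace X) :
    SpaceIso (tensorSpace (tensorSpace S T) R) (tensorSpace S (tensorSpace T R)) := by
  refine SpaceIso.of_equiv (Equiv.prodAssoc V W X) ?_ ?_
  · refine tensorSpace_induction (reindexMap (Equiv.prodAssoc V W X).symm) fun M hM C hC => ?_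
    refine tensorSpace_induction ((reindexMap (Equiv.prodAssoc V W X).symm).comp
      (kronRight C)) (fun A hA B hB => ?_) M hM
    convert kron_mem hA (kron_mem hB hC) using 1
    ext x y
    exact mul_assoc _ _ _
  · refine tensorSpace_induction (reindexMap (Equiv.prodAssoc V W X)) fun A hA M hM => ?_
    refine tensorSpace_induction ((reindexMap (Equiv.prodAssoc V W X)).comp
      (kronLeft A)) (fun B hB C hC => ?_) M hM
    convert kron_mem (kron_mem hA hB) hC using 1
    ext x y
    exact (mul_assoc _ _ _).symm

theorem spaceIso_one_tensor (S : OpSpace V) :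
    SpaceIso (tensorSpace (Submodule.span ℂ {1} : OpSpace Unit) S) S := by
  refine SpaceIso.of_equiv (Equiv.punitProd V) ?_ ?_
  · refine tensorSpace_induction (reindexMap (Equiv.punitProd V).symm) fun A hA B hB => ?_
    have : reindexMap (Equiv.punitProd V).symm (A ⊗ₖ B) = A () () • B := by
      ext x y
      rfl
    rw [this]
    exact S.smul_mem _ hB
  · intro B hB
    convert kron_mem (Submodule.mem_span_singleton_self (1 : Matrix Unit Unit ℂ)) hB using 1
    ext x y
    simp [Equiv.punitProd]

theorem spaceIso_zero_tensor (Z : OpSpace Empty) (S : OpSpace V) :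
    SpaceIso (tensorSpace Z S) Z := by
  refine SpaceIso.of_equiv (Equiv.equivOfIsEmpty _ _) (fun A hA => ?_) (fun B hB => ?_)
  · rw [Subsingleton.elim (Matrix.submatrix A _ _) 0]
    exact Z.zero_mem
  · rw [Subsingleton.elim (Matrix.submatrix B _ _) 0]
    exact Submodule.zero_mem _

theorem spaceIso_tensor_sum (S : OpSpace V) (T : OpSpace W) (R : OpSpace X) :
    SpaceIso (tensorSpace S (sumSpace T R)) (sumSpace (tensorSpace S T) (tensorSpace S R)) := by
  refine SpaceIso.of_equiv (Equiv.prodSumDistrib V W X) ?_ ?_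
  · refine tensorSpace_induction (reindexMap (Equiv.prodSumDistrib V W X).symm) ?_
    rintro A hA _ ⟨B, hB, C, hC, rfl⟩
    refine ⟨_, kron_mem hA hB, _, kron_mem hA hC, ?_⟩
    ext (x | x) (y | y) <;> simp [reindexMap, Equiv.prodSumDistrib, Equiv.sumProdDistrib]
  · rintro _ ⟨M, hM, N, hN, rfl⟩
    let L : Matrix (V × W) (V × W) ℂ →ₗ[ℂ] Matrix (V × (W ⊕ X)) (V × (W ⊕ X)) ℂ :=
      LinearMap.comp (σ₁₂ := RingHom.id ℂ) (reindexMap (Equiv.prodSumDistrib V W X))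
        { toFun := fun M => Matrix.fromBlocks M 0 0 0
          map_add' := fun a b => by simp [Matrix.fromBlocks_add]
          map_smul' := fun c a => by rw [RingHom.id_apply, Matrix.fromBlocks_smul]; simp }
    let L' : Matrix (V × X) (V × X) ℂ →ₗ[ℂ] Matrix (V × (W ⊕ X)) (V × (W ⊕ X)) ℂ :=
      LinearMap.comp (σ₁₂ := RingHom.id ℂ) (reindexMap (Equiv.prodSumDistrib V W X))
        { toFun := fun M => Matrix.fromBlocks 0 0 0 M
          map_add' := fun a b => by simp [Matrix.fromBlocks_add]
          map_smul' := fun c a => by rw [RingHom.id_apply, Matrix.fromBlocks_smul]; simp }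
    have h1 : L M ∈ tensorSpace S (sumSpace T R) := by
      refine tensorSpace_induction L (fun A hA B hB => ?_) M hM
      convert kron_mem hA (show Matrix.fromBlocks B 0 0 0 ∈ sumSpace T R from
        ⟨B, hB, 0, R.zero_mem, rfl⟩) using 1
      ext ⟨x, (x' | x')⟩ ⟨y, (y' | y')⟩ <;>
        simp [L, reindexMap, Equiv.prodSumDistrib, Equiv.sumProdDistrib]
    have h2 : L' N ∈ tensorSpace S (sumSpace T R) := by
      refine tensorSpace_induction L' (fun A hA B hB => ?_) N hN
      convert kron_mem hA (show Matrix.fromBlocks 0 0 0 B ∈ sumSpace T R from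
        ⟨0, T.zero_mem, B, hB, rfl⟩) using 1
      ext ⟨x, (x' | x')⟩ ⟨y, (y' | y')⟩ <;>
        simp [L', reindexMap, Equiv.prodSumDistrib, Equiv.sumProdDistrib]
    convert Submodule.add_mem _ h1 h2 using 1
    ext ⟨x, (x' | x')⟩ ⟨y, (y' | y')⟩ <;>
      simp [L, L', reindexMap, Equiv.prodSumDistrib, Equiv.sumProdDistrib]

/-! The inclusion of graphs on the level of operator spaces. -/

theorem mem_graphSpace {G : SimpleGraph V} {A : Matrix V V ℂ} :
    A ∈ graphSpace G ↔ ∀ x y, ¬ AdjEq G x y → A x y = 0 := by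
  constructor
  · intro h x y hxy
    induction h using Submodule.span_induction with
    | mem M hM =>
      obtain ⟨a, b, hab, rfl⟩ := hM
      rw [Matrix.single_apply, if_neg]
      rintro ⟨rfl, rfl⟩
      exact hxy hab
    | zero => rfl
    | add M N _ _ hM hN => rw [Matrix.add_apply, hM, hN, add_zero]
    | smul c M _ hM => rw [Matrix.smul_apply, hM, smul_zero]
  · intro h
    rw [Matrix.matrix_eq_sum_single A]
    refine Submodule.sum_mem _ fun x _ => Submodule.sum_mem _ fun y _ => ?_
    by_cases hxy : AdjEq G x y
    · have : Matrix.single x y (A x y) = A x y • Matrix.single x y (1 : ℂ) := by simp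
      rw [this]
      exact Submodule.smul_mem _ _ (Submodule.subset_span ⟨x, y, hxy, rfl⟩)
    · rw [h x y hxy, Matrix.single_zero]
      exact Submodule.zero_mem _

theorem graphSpace_iso {G : SimpleGraph V} {H : SimpleGraph W} (e : G ≃g H) :
    SpaceIso (graphSpace G) (graphSpace H) := by
  refine SpaceIso.of_equiv e.toEquiv (fun A hA => ?_) (fun B hB => ?_)
  · rw [mem_graphSpace] at hA ⊢
    intro x y hxy
    exact hA _ _ fun h => hxy ((adjEq_iso e.symm).1 h)
  · rw [mem_graphSpace] at hB ⊢
    intro x y hxy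
    exact hB _ _ fun h => hxy ((adjEq_iso e).1 h)

theorem graphSpace_sum (G : SimpleGraph V) (H : SimpleGraph W) :
    graphSpace (G ⊕g H) = sumSpace (graphSpace G) (graphSpace H) := by
  ext M
  rw [mem_graphSpace]
  constructor
  · intro h
    refine ⟨M.toBlocks₁₁, ?_, M.toBlocks₂₂, ?_, ?_⟩
    · exact mem_graphSpace.2 fun x y hxy => h _ _ fun k => hxy (adjEq_sum_inl.1 k)
    · exact mem_graphSpace.2 fun x y hxy => h _ _ fun k => hxy (adjEq_sum_inr.1 k)
    · ext (x | x) (y | y)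
      · rfl
      · exact h _ _ adjEq_sum_inl_inr.1
      · exact h _ _ adjEq_sum_inr_inl.1
      · rfl
  · rintro ⟨A, hA, B, hB, rfl⟩ (x | x) (y | y) hxy
    · exact mem_graphSpace.1 hA x y fun k => hxy (adjEq_sum_inl.2 k)
    · rfl
    · rfl
    · exact mem_graphSpace.1 hB x y fun k => hxy (adjEq_sum_inr.2 k)

theorem graphSpace_strong (G : SimpleGraph V) (H : SimpleGraph W) :
    graphSpace (strongProd G H) = tensorSpace (graphSpace G) (graphSpace H) := by
  refine le_antisymm (Submodule.span_le.2 ?_) (Submodule.span_le.2 ?_)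
  · rintro _ ⟨⟨x, x'⟩, ⟨y, y'⟩, h, rfl⟩
    have h' := adjEq_strongProd.1 h
    have := kron_mem (S := graphSpace G) (T := graphSpace H)
      (Submodule.subset_span ⟨x, y, h'.1, rfl⟩) (Submodule.subset_span ⟨x', y', h'.2, rfl⟩)
    rwa [Matrix.single_kronecker_single, mul_one] at this
  · rintro _ ⟨A, hA, B, hB, rfl⟩
    refine mem_graphSpace.2 fun p q hpq => ?_
    rw [Matrix.kroneckerMap_apply]
    by_cases h : AdjEq G p.1 q.1
    · rw [mem_graphSpace.1 hB _ _ fun k => hpq (adjEq_strongProd.2 ⟨h, k⟩), mul_zero]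
    · rw [mem_graphSpace.1 hA _ _ h, zero_mul]

theorem graphSpace_unit : graphSpace (⊥ : SimpleGraph Unit) = Submodule.span ℂ {1} := by
  ext A
  refine ⟨fun _ => ?_, fun _ => mem_graphSpace.2 fun x y h => (h (Or.inl rfl)).elim⟩
  refine Submodule.mem_span_singleton.2 ⟨A () (), ?_⟩
  ext
  simp

end Spaces

/-! ## Noncommutative graphs -/

/-- A noncommutative graph: a subspace `S` of the operators on `ℂ^V` with `1 ∈ S` and `S* = S`. -/
structure NCGraph where
  V : Type
  [fintypeV : Fintype V]
  [decEqV : DecidableEq V]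
  space : OpSpace V
  one_mem : 1 ∈ space
  star_mem : ∀ A ∈ space, Aᴴ ∈ space

attribute [instance] NCGraph.fintypeV NCGraph.decEqV

namespace NCGraph

instance setoid : Setoid NCGraph where
  r S T := SpaceIso S.space T.space
  iseqv := ⟨fun S => SpaceIso.refl S.space, SpaceIso.symm, SpaceIso.trans⟩

/-- Direct sum. -/
def directSum (S T : NCGraph) : NCGraph where
  V := S.V ⊕ T.V
  space := sumSpace S.space T.space
  one_mem := ⟨1, S.one_mem, 1, T.one_mem, Matrix.fromBlocks_one.symm⟩
  star_mem := by
    rintro _ ⟨A, hA, B, hB, rfl⟩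
    exact ⟨Aᴴ, S.star_mem A hA, Bᴴ, T.star_mem B hB, by simp [Matrix.fromBlocks_conjTranspose]⟩

/-- Tensor product. -/
def tensor (S T : NCGraph) : NCGraph where
  V := S.V × T.V
  space := tensorSpace S.space T.space
  one_mem := by
    have := kron_mem S.one_mem T.one_mem
    rwa [Matrix.one_kronecker_one] at this
  star_mem := by
    intro M hM
    induction hM using Submodule.span_induction with
    | mem M hM =>
      obtain ⟨A, hA, B, hB, rfl⟩ := hM
      rw [Matrix.conjTranspose_kronecker]
      exact kron_mem (S.star_mem A hA) (T.star_mem B hB)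
    | zero => rw [Matrix.conjTranspose_zero]; exact Submodule.zero_mem _
    | add M N _ _ hM hN => rw [Matrix.conjTranspose_add]; exact Submodule.add_mem _ hM hN
    | smul c M _ hM => rw [Matrix.conjTranspose_smul]; exact Submodule.smul_mem _ _ hM

/-- The confusability graph `ℂ I` of the identity channel on the operators on `ℂ^V`. -/
def scalars (V : Type) [Fintype V] [DecidableEq V] : NCGraph where
  V := V
  space := Submodule.span ℂ {1}
  one_mem := Submodule.mem_span_singleton_self _
  star_mem := by
    intro M hM
    obtain ⟨c, rfl⟩ := Submodule.mem_span_singleton.1 hM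
    rw [Matrix.conjTranspose_smul, Matrix.conjTranspose_one]
    exact Submodule.smul_mem _ _ (Submodule.mem_span_singleton_self _)

/-- The noncommutative graph of a graph. -/
def ofGraph (G : FinGraph) : NCGraph where
  V := G.V
  space := graphSpace G.graph
  one_mem := mem_graphSpace.2 fun _ _ h => Matrix.one_apply_ne fun k => h (Or.inl k)
  star_mem := by
    intro A hA
    refine mem_graphSpace.2 fun x y h => ?_
    rw [Matrix.conjTranspose_apply, mem_graphSpace.1 hA y x fun k => h k.symm, star_zero]

end NCGraph

/-- The set `𝒢_nc` of isomorphism classes of noncommutative graphs. -/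
def NCGraphClass : Type 1 := Quotient NCGraph.setoid

namespace NCGraphClass

instance : Zero NCGraphClass := ⟨Quotient.mk _ (NCGraph.scalars Empty)⟩
instance : One NCGraphClass := ⟨Quotient.mk _ (NCGraph.scalars Unit)⟩
instance : Add NCGraphClass :=
  ⟨Quotient.map₂ NCGraph.directSum fun _ _ h _ _ h' => SpaceIso.sum h h'⟩
instance : Mul NCGraphClass :=
  ⟨Quotient.map₂ NCGraph.tensor fun _ _ h _ _ h' => SpaceIso.tensor h h'⟩

protected theorem add_comm' (a b : NCGraphClass) : a + b = b + a := by
  induction a using Quotient.inductionOn with | _ S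
  induction b using Quotient.inductionOn with | _ T
  exact Quotient.sound (spaceIso_sum_comm S.space T.space)

protected theorem zero_add' (a : NCGraphClass) : 0 + a = a := by
  induction a using Quotient.inductionOn with | _ S
  exact Quotient.sound (spaceIso_zero_sum _ S.space)

protected theorem mul_comm' (a b : NCGraphClass) : a * b = b * a := by
  induction a using Quotient.inductionOn with | _ S
  induction b using Quotient.inductionOn with | _ T
  exact Quotient.sound (spaceIso_tensor_comm S.space T.space)

protected theorem one_mul' (a : NCGraphClass) : 1 * a = a := by
  induction a using Quotient.inductionOn with | _ S
  exact Quotient.sound (spaceIso_one_tensor S.space)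

protected theorem zero_mul' (a : NCGraphClass) : 0 * a = 0 := by
  induction a using Quotient.inductionOn with | _ S
  exact Quotient.sound (spaceIso_zero_tensor _ S.space)

protected theorem left_distrib' (a b c : NCGraphClass) : a * (b + c) = a * b + a * c := by
  induction a using Quotient.inductionOn with | _ S
  induction b using Quotient.inductionOn with | _ T
  induction c using Quotient.inductionOn with | _ R
  exact Quotient.sound (spaceIso_tensor_sum S.space T.space R.space)

/-- The semiring of noncommutative graphs: direct sum as addition, tensor product as
multiplication. -/
instance : CommSemiring NCGraphClass where
  add_assoc a b c := by
    induction a using Quotient.inductionOn with | _ S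
    induction b using Quotient.inductionOn with | _ T
    induction c using Quotient.inductionOn with | _ R
    exact Quotient.sound (spaceIso_sum_assoc S.space T.space R.space)
  zero_add := NCGraphClass.zero_add'
  add_zero a := (NCGraphClass.add_comm' a 0).trans (NCGraphClass.zero_add' a)
  add_comm := NCGraphClass.add_comm'
  nsmul := nsmulRec
  mul_assoc a b c := by
    induction a using Quotient.inductionOn with | _ S
    induction b using Quotient.inductionOn with | _ T
    induction c using Quotient.inductionOn with | _ R
    exact Quotient.sound (spaceIso_tensor_assoc S.space T.space R.space)
  one_mul := NCGraphClass.one_mul'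
  mul_one a := (NCGraphClass.mul_comm' a 1).trans (NCGraphClass.one_mul' a)
  left_distrib := NCGraphClass.left_distrib'
  right_distrib a b c := by
    rw [NCGraphClass.mul_comm', NCGraphClass.left_distrib', NCGraphClass.mul_comm' c a,
      NCGraphClass.mul_comm' c b]
  zero_mul := NCGraphClass.zero_mul'
  mul_zero a := (NCGraphClass.mul_comm' a 0).trans (NCGraphClass.zero_mul' a)
  mul_comm := NCGraphClass.mul_comm'

/-- The cohomomorphism preorder on noncommutative graphs. -/
instance : Preorder NCGraphClass where
  le := Quotient.lift₂ (fun T S : NCGraph => SpaceCohom T.space S.space) fun _ _ _ _ h h' => propext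
    ⟨fun k => (SpaceIso.symm h).cohom.trans (k.trans (SpaceIso.cohom h')),
      fun k => (SpaceIso.cohom h).trans (k.trans (SpaceIso.symm h').cohom)⟩
  le_refl a := by
    induction a using Quotient.inductionOn with | _ S
    exact (SpaceIso.refl S.space).cohom
  le_trans a b c := by
    induction a using Quotient.inductionOn with | _ S
    induction b using Quotient.inductionOn with | _ T
    induction c using Quotient.inductionOn with | _ R
    exact SpaceCohom.trans

/-- The noiseless quantum channel of dimension `d`. -/
def idealQuantum (d : ℕ) : NCGraphClass := Quotient.mk _ (NCGraph.scalars (Fin d))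

/-- The inclusion `𝒢 → 𝒢_nc`. -/
def ofGraph : GraphClass →+* NCGraphClass where
  toFun := Quotient.map NCGraph.ofGraph fun _ _ h => h.elim fun e => graphSpace_iso e
  map_zero' := Quotient.sound (by
    change SpaceIso (graphSpace (⊥ : SimpleGraph Empty)) (Submodule.span ℂ {1})
    rw [Subsingleton.elim (graphSpace (⊥ : SimpleGraph Empty)) (Submodule.span ℂ {1})]
    exact SpaceIso.refl _)
  map_one' := Quotient.sound (by
    change SpaceIso (graphSpace (⊥ : SimpleGraph Unit)) (Submodule.span ℂ {1})
    rw [graphSpace_unit]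
    exact SpaceIso.refl _)
  map_add' a b := by
    induction a using Quotient.inductionOn with | _ G
    induction b using Quotient.inductionOn with | _ H
    refine Quotient.sound ?_
    change SpaceIso (graphSpace (G.graph ⊕g H.graph))
      (sumSpace (graphSpace G.graph) (graphSpace H.graph))
    rw [graphSpace_sum]
    exact SpaceIso.refl _
  map_mul' a b := by
    induction a using Quotient.inductionOn with | _ G
    induction b using Quotient.inductionOn with | _ H
    refine Quotient.sound ?_
    change SpaceIso (graphSpace (strongProd G.graph H.graph))
      (tensorSpace (graphSpace G.graph) (graphSpace H.graph))
    rw [graphSpace_strong]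
    exact SpaceIso.refl _

end NCGraphClass

/-! ## The semiring `𝒜`, asymptotic spectra and admissible exponents -/

/-- The subsemiring `𝒜` of `𝒢_nc` generated by all graphs and all noiseless quantum channels, with
the restricted operations and preorder. -/
def semiringA : Subsemiring NCGraphClass :=
  Subsemiring.closure (Set.range NCGraphClass.ofGraph ∪ Set.range NCGraphClass.idealQuantum)

/-- The inclusion `𝒢 → 𝒜`. -/
def graphA : GraphClass →+* semiringA :=
  NCGraphClass.ofGraph.codRestrict semiringA
    fun G => Subsemiring.subset_closure (Or.inl ⟨G, rfl⟩)

/-- The noiseless quantum channel of dimension `d` as an element of `𝒜`. -/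
def idealQuantumA (d : ℕ) : semiringA :=
  ⟨NCGraphClass.idealQuantum d, Subsemiring.subset_closure (Or.inr ⟨d, rfl⟩)⟩

/-- The asymptotic spectrum `Δ(S, ≤)`: the monotone semiring homomorphisms `S → ℝ≥0`. -/
def asymptoticSpectrum (S : Type*) [CommSemiring S] [Preorder S] : Set (S →+* ℝ≥0) :=
  {f | Monotone f}

/-- `α ≥ 1` is an admissible exponent for the graph parameter `f` if
`⨁_{d = 1}^r G_d ⊗ (ideal quantum channel of dimension d) ↦ ∑_{d = 1}^r f(G_d) d^α` defines an
element of `Δ(𝒜, ≤)`. -/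
def IsAdmissibleExponent (f : GraphClass → ℝ) (α : ℝ) : Prop :=
  1 ≤ α ∧ ∃ F ∈ asymptoticSpectrum semiringA, ∀ (r : ℕ) (G : ℕ → GraphClass),
    (F (∑ d ∈ Finset.Icc 1 r, graphA (G d) * idealQuantumA d) : ℝ) =
      ∑ d ∈ Finset.Icc 1 r, f (G d) * (d : ℝ) ^ α

end

/-! ## Noiseless channels and orthonormal representations -/

/-! The obstruction is a conflict of growth rates. An orthonormal representation of `G` in `ℂ^n`
gives `𝒮_G ≤ 𝒬_n` (`spaceCohom_graphSpace_scalars`), and `𝒬_n ≤ 𝒬_2^k` as soon as `n ≤ 2^k`. A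
monotone homomorphism `F` therefore satisfies `F(𝒮_G) ≤ F(𝒬_2)^k`, which for the least such `k` is
polynomial in `n`, whatever the value `F(𝒬_2)` is.

The fractional clique cover number can be exponential in `n`. For an odd prime `p` and `n = 4p`,
take `2^(n-2)` sign vectors of length `n` whose inner products are multiples of 4 and, for distinct
vectors, smaller than `n` in absolute value; join two of them when they are not orthogonal.
Normalised, the vectors form an orthonormal representation in dimension `n` (`graphA_signGraph_le`).
In a clique no inner product of distinct vectors is divisible by `p`, since otherwise `4p` would
divide it and it would vanish. The Frankl–Wilson polynomial method (`card_le_finrank_signPoly`) with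
a binomial estimate (`finrank_signPoly_mul_le`) then bounds cliques by `(256/27)^p`. Dividing the
`16^p / 4` vertices by this bound shows that the fractional clique cover number is at least
`(27/16)^p / 4` (`fractionalCliqueCover_signGraph`), which exceeds every polynomial in `p`. -/

theorem tensorSpace_scalars {V W : Type} [DecidableEq V] [DecidableEq W] :
    tensorSpace (Submodule.span ℂ {1} : OpSpace V) (Submodule.span ℂ {1} : OpSpace W) =
      Submodule.span ℂ {1} := by
  refine le_antisymm (Submodule.span_le.2 ?_) (Submodule.span_le.2 ?_)
  · rintro _ ⟨A, hA, B, hB, rfl⟩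
    obtain ⟨a, rfl⟩ := Submodule.mem_span_singleton.1 hA
    obtain ⟨b, rfl⟩ := Submodule.mem_span_singleton.1 hB
    rw [Matrix.smul_kronecker, Matrix.kronecker_smul, Matrix.one_kronecker_one]
    exact Submodule.smul_mem _ _ (Submodule.smul_mem _ _ (Submodule.mem_span_singleton_self _))
  · rintro _ rfl
    have := kron_mem (Submodule.mem_span_singleton_self (R := ℂ) (1 : Matrix V V ℂ))
      (Submodule.mem_span_singleton_self (R := ℂ) (1 : Matrix W W ℂ))
    rwa [Matrix.one_kronecker_one] at this

section Channels

variable {V W : Type} [Fintype V] [DecidableEq V] [Fintype W] [DecidableEq W]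

theorem spaceIso_scalars (e : V ≃ W) :
    SpaceIso (Submodule.span ℂ {1} : OpSpace V) (Submodule.span ℂ {1} : OpSpace W) := by
  refine SpaceIso.of_equiv e (fun A hA => ?_) (fun B hB => ?_)
  · obtain ⟨c, rfl⟩ := Submodule.mem_span_singleton.1 hA
    refine Submodule.mem_span_singleton.2 ⟨c, ?_⟩
    rw [Matrix.submatrix_smul, Pi.smul_apply, Pi.smul_apply, Matrix.submatrix_one_equiv]
  · obtain ⟨c, rfl⟩ := Submodule.mem_span_singleton.1 hB
    refine Submodule.mem_span_singleton.2 ⟨c, ?_⟩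
    rw [Matrix.submatrix_smul, Pi.smul_apply, Pi.smul_apply, Matrix.submatrix_one_equiv]

/-- The coordinate isometry induced by `e` serves as the only Kraus operator: conjugating a scalar
by an isometry gives the same scalar. -/
theorem spaceCohom_scalars_of_injective {e : V → W} (he : Function.Injective e) :
    SpaceCohom (Submodule.span ℂ {1} : OpSpace V) (Submodule.span ℂ {1} : OpSpace W) := by
  have key : ((1 : Matrix W W ℂ).submatrix id e)ᴴ * (1 : Matrix W W ℂ).submatrix id e = 1 := by
    ext x y
    simp [Matrix.mul_apply, Matrix.one_apply, he.eq_iff, apply_ite, eq_comm]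
  refine ⟨Unit, inferInstance, fun _ => (1 : Matrix W W ℂ).submatrix id e, by simpa using key, ?_⟩
  rintro - - A hA
  obtain ⟨c, rfl⟩ := Submodule.mem_span_singleton.1 hA
  rw [Matrix.mul_smul, Matrix.smul_mul, Matrix.mul_one, key]
  exact Submodule.smul_mem _ _ (Submodule.mem_span_singleton_self _)

/-- A graph with an orthonormal representation in `ℂ^W` is bounded by the noiseless channel on
`ℂ^W`. -/
theorem spaceCohom_graphSpace_scalars (G : SimpleGraph V) (v : V → W → ℂ)
    (hv : ∀ x, star (v x) ⬝ᵥ v x = 1) (ho : ∀ x y, ¬ AdjEq G x y → star (v x) ⬝ᵥ v y = 0) :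
    SpaceCohom (graphSpace G) (Submodule.span ℂ {1} : OpSpace W) := by
  -- The Kraus operators are `E_x = |v_x⟩⟨x|`, so that `E_x* E_y = ⟨v_x, v_y⟩ |x⟩⟨y|`. Normalisation
  -- gives `∑ E_x* E_x = 1`, and orthogonality removes exactly the matrix units outside the graph
  -- space.
  have key : ∀ x y, (Matrix.vecMulVec (v x) (Pi.single x 1))ᴴ *
      Matrix.vecMulVec (v y) (Pi.single y 1) =
      (star (v x) ⬝ᵥ v y) • Matrix.single x y (1 : ℂ) := by
    intro x y
    rw [Matrix.conjTranspose_vecMulVec, Matrix.vecMulVec_mul_vecMulVec]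
    ext i j
    simp [Matrix.vecMulVec_apply, Matrix.single_apply, Pi.single_apply, apply_ite]
    grind
  refine ⟨V, inferInstance, fun x => Matrix.vecMulVec (v x) (Pi.single x 1), ?_, ?_⟩
  · simp only [key, hv, one_smul]
    ext i j
    simp [Matrix.sum_apply, Matrix.single_apply, Matrix.one_apply, ite_and]
  · intro x y A hA
    obtain ⟨c, rfl⟩ := Submodule.mem_span_singleton.1 hA
    rw [Matrix.mul_smul, Matrix.smul_mul, Matrix.mul_one, key]
    refine Submodule.smul_mem _ _ ?_
    by_cases h : AdjEq G x y
    · exact Submodule.smul_mem _ _ (Submodule.subset_span ⟨x, y, h, rfl⟩)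
    · rw [ho x y h, zero_smul]
      exact Submodule.zero_mem _

end Channels

/-! ### Noiseless channels as powers of the qubit channel -/

theorem idealQuantumA_one : idealQuantumA 1 = 1 :=
  Subtype.ext (Quotient.sound (spaceIso_scalars (Equiv.equivPUnit (Fin 1))))

theorem idealQuantumA_mul (m n : ℕ) :
    idealQuantumA (m * n) = idealQuantumA m * idealQuantumA n := by
  refine Subtype.ext (Quotient.sound ?_)
  change SpaceIso (Submodule.span ℂ {1} : OpSpace (Fin (m * n)))
    (tensorSpace (Submodule.span ℂ {1} : OpSpace (Fin m)) (Submodule.span ℂ {1} : OpSpace (Fin n)))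
  rw [tensorSpace_scalars]
  exact spaceIso_scalars finProdFinEquiv.symm

theorem idealQuantumA_two_pow (k : ℕ) : idealQuantumA (2 ^ k) = idealQuantumA 2 ^ k := by
  induction k with
  | zero => rw [pow_zero, pow_zero, idealQuantumA_one]
  | succ k ih => rw [pow_succ, idealQuantumA_mul, ih, pow_succ]

/-- Rounding the dimension up to a power of two leaves the value on `𝒬_2` as the only unknown in the
upper bound for a monotone homomorphism. -/
theorem graphA_le_idealQuantumA_two_pow (G : FinGraph) {W : Type} [Fintype W] [DecidableEq W]
    (v : G.V → W → ℂ) (hv : ∀ x, star (v x) ⬝ᵥ v x = 1)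
    (ho : ∀ x y, ¬ AdjEq G.graph x y → star (v x) ⬝ᵥ v y = 0) {k : ℕ}
    (hk : Fintype.card W ≤ 2 ^ k) :
    graphA (Quotient.mk _ G) ≤ idealQuantumA 2 ^ k := by
  rw [← idealQuantumA_two_pow]
  exact (spaceCohom_graphSpace_scalars G.graph v hv ho).trans
    (spaceCohom_scalars_of_injective
      (((Fin.castLE_injective hk).comp (Fintype.equivFin W).injective)))

/-! ## A lower bound on the fractional chromatic number -/

/-- Weight 1 on every singleton is a fractional colouring. Nonemptiness is what allows a lower bound
to pass to the real infimum. -/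
theorem fractionalColoringValues_nonempty {V : Type} [Fintype V] [DecidableEq V]
    (G : SimpleGraph V) : (fractionalColoringValues G).Nonempty := by
  refine ⟨_, fun I => if I.card = 1 then 1 else 0, fun I => ?_, fun I hI => ?_, fun v => ?_, rfl⟩
  · dsimp only
    split_ifs <;> simp
  · obtain ⟨x, rfl⟩ := Finset.card_eq_one.1 (by simpa using hI)
    simp
  · refine le_trans (by simp) (Finset.single_le_sum (f := fun I : Finset V =>
      if v ∈ I then if I.card = 1 then (1 : ℝ) else 0 else 0) (fun I _ => ?_)
      (Finset.mem_univ {v}))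
    split_ifs <;> simp

/-- Double counting: summing the covering inequalities over all vertices counts each weight `w I`
exactly `I.card ≤ a` times. -/
theorem card_le_mul_fractionalChromaticNumber {V : Type} [Fintype V] [DecidableEq V]
    (G : SimpleGraph V) {a : ℝ} (ha : 0 < a)
    (h : ∀ I : Finset V, G.IsIndepSet (I : Set V) → (I.card : ℝ) ≤ a) :
    (Fintype.card V : ℝ) ≤ a * fractionalChromaticNumber G := by
  rw [← div_le_iff₀' ha]
  refine le_csInf (fractionalColoringValues_nonempty G) ?_
  rintro _ ⟨w, h0, h1, h2, rfl⟩
  rw [div_le_iff₀' ha]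
  calc (Fintype.card V : ℝ) = ∑ _v : V, 1 := by simp
    _ ≤ ∑ v : V, ∑ I : Finset V, if v ∈ I then w I else 0 := Finset.sum_le_sum fun v _ => h2 v
    _ = ∑ I : Finset V, I.card * w I := by
      rw [Finset.sum_comm]
      simp
    _ ≤ ∑ I : Finset V, a * w I := by
      refine Finset.sum_le_sum fun I _ => ?_
      rcases eq_or_ne (w I) 0 with hI | hI
      · simp [hI]
      · exact mul_le_mul_of_nonneg_right (h I (h1 I hI)) (h0 I)
    _ = a * ∑ I : Finset V, w I := by rw [Finset.mul_sum]

/-! ## The Frankl–Wilson bound for sign vectors -/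

section FranklWilson

variable {ι : Type*} [Fintype ι]

/-- The inner product of two sign vectors. -/
def signInner (x y : ι → ℤˣ) : ℤ := ∑ i, (x i : ℤ) * (y i : ℤ)

theorem signInner_self (x : ι → ℤˣ) : signInner x x = Fintype.card ι := by
  simp [signInner, ← Units.val_mul]

variable [DecidableEq ι] (R : Type*) [CommRing R]

/-- The square-free monomial `∏ i ∈ S, y i` as a function of the sign vector `y`. -/
def signMonomial (S : Finset ι) (y : ι → ℤˣ) : R := ∏ i ∈ S, ((y i : ℤ) : R)

/-- The functions of sign vectors that are polynomials of degree at most `k`. -/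
def signPoly (ι : Type*) [Fintype ι] [DecidableEq ι] (R : Type*) [CommRing R] (k : ℕ) :
    Submodule R ((ι → ℤˣ) → R) :=
  Submodule.span R (signMonomial R '' {S : Finset ι | S.card ≤ k})

variable {R}

theorem one_mem_signPoly (k : ℕ) : (1 : (ι → ℤˣ) → R) ∈ signPoly ι R k :=
  Submodule.subset_span ⟨∅, by simp, by ext; simp [signMonomial]⟩

/-- On sign vectors `y i ^ 2 = 1`, so a repeated variable cancels and the monomial stays
square-free. -/
theorem coord_mul_mem_signPoly {k : ℕ} (i : ι) {f : (ι → ℤˣ) → R} (hf : f ∈ signPoly ι R k) :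
    (fun y => ((y i : ℤ) : R)) * f ∈ signPoly ι R (k + 1) := by
  induction hf using Submodule.span_induction with
  | mem f hf =>
    obtain ⟨S, hS, rfl⟩ := hf
    have hS : S.card ≤ k := hS
    refine Submodule.subset_span ?_
    by_cases hi : i ∈ S
    · refine ⟨S.erase i, (Finset.card_erase_le.trans hS).trans k.le_succ, ?_⟩
      ext y
      have h1 : ((y i : ℤ) : R) * ((y i : ℤ) : R) = 1 := by
        rw [← Int.cast_mul, ← Units.val_mul, Int.units_mul_self, Units.val_one, Int.cast_one]
      rw [Pi.mul_apply, signMonomial, signMonomial, ← Finset.mul_prod_erase S _ hi, ← mul_assoc,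
        h1, one_mul]
    · refine ⟨insert i S, (Finset.card_insert_le _ _).trans (Nat.succ_le_succ hS), ?_⟩
      ext y
      rw [Pi.mul_apply, signMonomial, signMonomial, Finset.prod_insert hi]
  | zero => rw [mul_zero]; exact Submodule.zero_mem _
  | add f g _ _ hf hg => rw [mul_add]; exact Submodule.add_mem _ hf hg
  | smul c f _ hf => rw [mul_smul_comm]; exact Submodule.smul_mem _ _ hf

theorem signInner_pow_mem_signPoly (x : ι → ℤˣ) (k : ℕ) :
    (fun y => ((signInner x y : ℤ) : R)) ^ k ∈ signPoly ι R k := by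
  induction k with
  | zero => rw [pow_zero]; exact one_mem_signPoly 0
  | succ k ih =>
    have h : (fun y => ((signInner x y : ℤ) : R)) ^ (k + 1) =
        ∑ i, ((x i : ℤ) : R) • ((fun y : ι → ℤˣ => ((y i : ℤ) : R)) *
          (fun y => ((signInner x y : ℤ) : R)) ^ k) := by
      ext y
      simp [signInner, pow_succ', Finset.sum_mul, mul_assoc]
    rw [h]
    exact Submodule.sum_mem _ fun i _ => Submodule.smul_mem _ _ (coord_mul_mem_signPoly i ih)

/-- The dimension is at most the number of sets of size at most `k`. Give each set `S` the weight `3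
^ (n - S.card)`, where `n` is the number of coordinates: these sets weigh at least `3 ^ (n - k)`
each, and all sets together weigh `(1 + 3) ^ n`. The base 3 is the optimal one when `k` is about `n
/ 4`. -/
theorem finrank_signPoly_mul_le {K : Type*} [Field K] {k : ℕ} (hk : k ≤ Fintype.card ι) :
    Module.finrank K (signPoly ι K k) * 3 ^ (Fintype.card ι - k) ≤ 4 ^ Fintype.card ι := by
  classical
  have h1 : Module.finrank K (signPoly ι K k) ≤
      (Finset.univ.filter fun S : Finset ι => S.card ≤ k).card := by
    have : signPoly ι K k = Submodule.span K
        (((Finset.univ.filter fun S : Finset ι => S.card ≤ k).image (signMonomial K) :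
          Finset ((ι → ℤˣ) → K)) : Set ((ι → ℤˣ) → K)) := by
      simp [signPoly]
    rw [this]
    exact (finrank_span_finset_le_card _).trans Finset.card_image_le
  calc _ ≤ (Finset.univ.filter fun S : Finset ι => S.card ≤ k).card * 3 ^ (Fintype.card ι - k) :=
        Nat.mul_le_mul_right _ h1
    _ ≤ ∑ S ∈ Finset.univ.filter (fun S : Finset ι => S.card ≤ k),
          3 ^ (Fintype.card ι - S.card) := by
      rw [← smul_eq_mul]
      refine Finset.card_nsmul_le_sum _ _ _ fun S hS => ?_
      have := (Finset.mem_filter.1 hS).2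
      exact Nat.pow_le_pow_right (by norm_num) (by omega)
    _ ≤ ∑ S : Finset ι, 3 ^ (Fintype.card ι - S.card) :=
      Finset.sum_le_sum_of_subset (Finset.filter_subset _ _)
    _ = 4 ^ Fintype.card ι := by
      simpa only [one_pow, one_mul] using Fintype.sum_pow_mul_eq_add_pow ι (1 : ℕ) 3

/-- A family of sign vectors whose pairwise inner products do not vanish modulo `p`, while the
squared norms do, is bounded by the number of square-free monomials of degree less than `p`. -/
theorem card_le_finrank_signPoly {J : Type*} [Fintype J] (p : ℕ) [Fact p.Prime]
    (hp : p ∣ Fintype.card ι) (x : J → ι → ℤˣ)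
    (hx : ∀ i j, i ≠ j → ¬ (p : ℤ) ∣ signInner (x i) (x j)) :
    Fintype.card J ≤ Module.finrank (ZMod p) (signPoly ι (ZMod p) (p - 1)) := by
  classical
  have hp1 : p - 1 ≠ 0 := Nat.sub_ne_zero_of_lt (Fact.out : p.Prime).one_lt
  -- By Fermat, `1 - t ^ (p - 1)` is the indicator of `t = 0` in `ZMod p`. Evaluated at the given
  -- vectors, these polynomials of degree at most `p - 1` form the identity matrix, hence are
  -- linearly independent.
  let P : J → (ι → ℤˣ) → ZMod p :=
    fun j => 1 - (fun y => ((signInner (x j) y : ℤ) : ZMod p)) ^ (p - 1)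
  have hP : ∀ i j, P i (x j) = if i = j then 1 else 0 := by
    intro i j
    change 1 - ((signInner (x i) (x j) : ℤ) : ZMod p) ^ (p - 1) = _
    split_ifs with h
    · subst h
      have : ((signInner (x i) (x i) : ℤ) : ZMod p) = 0 := by
        rw [signInner_self, Int.cast_natCast]
        exact (ZMod.natCast_eq_zero_iff _ _).2 hp
      rw [this, zero_pow hp1, sub_zero]
    · rw [ZMod.pow_card_sub_one_eq_one, sub_self]
      exact fun h0 => hx i j h ((ZMod.intCast_zmod_eq_zero_iff_dvd _ _).1 h0)
  have hli : LinearIndependent (ZMod p) P := by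
    refine Fintype.linearIndependent_iff.2 fun c hc j => ?_
    have := congrFun hc (x j)
    simpa [Finset.sum_apply, hP] using this
  rw [← finrank_span_eq_card hli]
  refine Submodule.finrank_mono (Submodule.span_le.2 ?_)
  rintro _ ⟨j, rfl⟩
  exact Submodule.sub_mem _ (one_mem_signPoly _) (signInner_pow_mem_signPoly _ _)

end FranklWilson

/-! ## The orthogonality graph of sign vectors -/

section SignGraph

variable {m : ℕ}

/-- Extend a sign vector by the entries `1` and `∏ i, x i`. -/
def extendSign (x : Fin m → ℤˣ) : Option (Option (Fin m)) → ℤˣ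
  | none => 1
  | some none => ∏ i, x i
  | some (some i) => x i

/-- The two extra entries have separate purposes: the constant entry rules out antipodal pairs, and
the product entry makes the number of disagreements between two extended vectors even. -/
theorem signInner_extendSign (x y : Fin m → ℤˣ) :
    signInner (extendSign x) (extendSign y) =
      1 + ((∏ i, (x i * y i) : ℤˣ) : ℤ) + ∑ i, ((x i * y i : ℤˣ) : ℤ) := by
  simp [signInner, extendSign, Fintype.sum_option, Finset.prod_mul_distrib, add_assoc]

/-- A new factor 1 leaves the first expression unchanged, and a new factor -1 adds `2 - 2q`, where
`q = ±1` is the old product; this is 0 or 4. The parity statement serves to replace the sum by its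
negative modulo 4 in `four_dvd_signInner_extendSign`. -/
theorem four_dvd_prod_sub_sum {α : Type*} (s : Finset α) (z : α → ℤˣ) :
    (4 : ℤ) ∣ ((∏ i ∈ s, z i : ℤˣ) : ℤ) - ∑ i ∈ s, (z i : ℤ) - 1 + s.card ∧
      (2 : ℤ) ∣ ∑ i ∈ s, (z i : ℤ) + s.card := by
  classical
  induction s using Finset.induction_on with
  | empty => simp
  | insert a s ha ih =>
    rw [Finset.prod_insert ha, Finset.sum_insert ha, Finset.card_insert_of_notMem ha]
    push_cast [Units.val_mul] at ih ⊢
    generalize hs : ∑ i ∈ s, (z i : ℤ) = t at ih ⊢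
    have hq : (∏ i ∈ s, (z i : ℤ)) = 1 ∨ (∏ i ∈ s, (z i : ℤ)) = -1 := by
      rw [← Units.coe_prod]
      rcases Int.units_eq_one_or (∏ i ∈ s, z i) with h | h <;> simp [h]
    rcases Int.units_eq_one_or (z a) with h | h <;> rcases hq with hq | hq <;>
      rw [h, hq] <;> rw [hq] at ih <;> push_cast <;> omega

theorem four_dvd_signInner_extendSign (hm : 4 ∣ m + 2) (x y : Fin m → ℤˣ) :
    (4 : ℤ) ∣ signInner (extendSign x) (extendSign y) := by
  rw [signInner_extendSign]
  have := four_dvd_prod_sub_sum Finset.univ fun i => x i * y i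
  rw [Finset.card_univ, Fintype.card_fin] at this
  omega

/-- The constant entry contributes `+1`, which excludes the value `-(m + 2)`; a coordinate where `x`
and `y` differ excludes `m + 2`. -/
theorem abs_signInner_extendSign_lt {x y : Fin m → ℤˣ} (h : x ≠ y) :
    |signInner (extendSign x) (extendSign y)| < m + 2 := by
  have hb : ∀ u : ℤˣ, -1 ≤ (u : ℤ) ∧ (u : ℤ) ≤ 1 := by
    intro u
    rcases Int.units_eq_one_or u with h | h <;> simp [h]
  have h1 := hb (∏ i, (x i * y i))
  have h2 : -(m : ℤ) ≤ ∑ i, ((x i * y i : ℤˣ) : ℤ) := by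
    have := Finset.sum_le_sum fun i (_ : i ∈ Finset.univ) => (hb (x i * y i)).1
    simpa using this
  have h3 : ∑ i, ((x i * y i : ℤˣ) : ℤ) < m := by
    obtain ⟨i, hi⟩ := Function.ne_iff.1 h
    have hi' : ((x i * y i : ℤˣ) : ℤ) < 1 := by
      rcases Int.units_eq_one_or (x i) with hx | hx <;>
        rcases Int.units_eq_one_or (y i) with hy | hy <;> simp_all
    have := Finset.sum_lt_sum (fun i (_ : i ∈ Finset.univ) => (hb (x i * y i)).2)
      ⟨i, Finset.mem_univ i, hi'⟩
    simpa using this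
  rw [signInner_extendSign, abs_lt]
  constructor <;> linarith

/-- Two sign vectors are adjacent if their extensions are not orthogonal. -/
def signGraph (m : ℕ) : FinGraph where
  V := Fin m → ℤˣ
  graph :=
    { Adj := fun x y => x ≠ y ∧ signInner (extendSign x) (extendSign y) ≠ 0
      symm := ⟨fun x y h => ⟨h.1.symm, by simpa only [signInner, mul_comm] using h.2⟩⟩
      loopless := ⟨fun _ h => h.1 rfl⟩ }

/-- Independent sets of the complement are families of pairwise non-orthogonal vectors, of size at
most `(256/27)^p` by Frankl–Wilson. There are `2^m = 16^p / 4` vertices, and `16 · 27 / 256 = 27 /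
16`. -/
theorem fractionalCliqueCover_signGraph {p : ℕ} (hp : p.Prime) (h2 : p ≠ 2) (hm : m + 2 = 4 * p) :
    (27 / 16 : ℝ) ^ p ≤ 4 * fractionalCliqueCover (Quotient.mk _ (signGraph m)) := by
  have : Fact p.Prime := ⟨hp⟩
  have hcard : Fintype.card (Option (Option (Fin m))) = 4 * p := by
    simpa using hm
  have hpos : (0 : ℝ) < (256 / 27) ^ p := by positivity
  have key := card_le_mul_fractionalChromaticNumber (signGraph m).graphᶜ hpos fun I hI => by
    have h1 : Fintype.card I ≤ _ := card_le_finrank_signPoly p (hcard ▸ Dvd.intro_left 4 rfl)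
      (fun i : I => extendSign (m := m) i.1) fun i j hij hdvd => by
        have hij' : i.1 ≠ j.1 := fun h => hij (Subtype.ext h)
        have h0 : signInner (extendSign (m := m) i.1) (extendSign (m := m) j.1) = 0 := by
          refine Int.eq_zero_of_abs_lt_dvd (m := 4 * p) ?_ ?_
          · refine IsCoprime.mul_dvd ?_ (four_dvd_signInner_extendSign ⟨p, hm⟩ _ _) hdvd
            have : Nat.Coprime (2 ^ 2) p :=
              Nat.Coprime.pow_left 2 ((Nat.coprime_primes Nat.prime_two hp).2 h2.symm)
            exact_mod_cast Nat.isCoprime_iff_coprime.2 this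
          · have := abs_signInner_extendSign_lt hij'
            have hm' : (m : ℤ) + 2 = 4 * p := by exact_mod_cast hm
            rwa [hm'] at this
        refine hI i.2 j.2 hij' ((SimpleGraph.compl_adj _ _ _).2 ⟨hij', fun h => h.2 h0⟩)
    have h3 := finrank_signPoly_mul_le (ι := Option (Option (Fin m))) (K := ZMod p) (k := p - 1)
      (by omega)
    have h4 : I.card * 3 ^ (3 * p) ≤ 4 ^ (4 * p) := by
      rw [hcard] at h3
      -- The exponent `4p - (p - 1) = 3p + 1` is relaxed to `3p`.
      refine le_trans (Nat.mul_le_mul ?_ (Nat.pow_le_pow_right (by norm_num) (by omega))) h3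
      simpa using h1
    have h5 : (I.card : ℝ) * 27 ^ p ≤ 256 ^ p := by
      rw [pow_mul, pow_mul] at h4
      exact_mod_cast h4
    rw [div_pow, le_div_iff₀ (by positivity)]
    exact h5
  have hV : (Fintype.card (signGraph m).V : ℝ) * 4 = 16 ^ p := by
    have : Fintype.card (signGraph m).V = 2 ^ m := by
      change Fintype.card (Fin m → ℤˣ) = _
      simp
    rw [this]
    have : 2 ^ m * 4 = 16 ^ p := by
      calc 2 ^ m * 4 = 2 ^ (m + 2) := by rw [pow_add]; rfl
        _ = 16 ^ p := by rw [hm, pow_mul]; rfl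
    exact_mod_cast this
  change _ ≤ 4 * fractionalChromaticNumber (signGraph m).graphᶜ
  have h6 : (27 / 16 : ℝ) ^ p * (256 / 27) ^ p = 16 ^ p := by rw [← mul_pow]; norm_num
  refine le_of_mul_le_mul_right ?_ hpos
  rw [h6, ← hV]
  linarith

/-- The extended sign vectors divided by `√(m + 2)` are an orthonormal representation, because
non-adjacency was defined by their orthogonality. -/
theorem graphA_signGraph_le {k : ℕ} (hk : m + 2 ≤ 2 ^ k) :
    graphA (Quotient.mk _ (signGraph m)) ≤ idealQuantumA 2 ^ k := by
  have hs : ((√(m + 2 : ℝ) : ℝ) : ℂ) * (√(m + 2 : ℝ) : ℝ) = m + 2 := by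
    rw [← Complex.ofReal_mul, Real.mul_self_sqrt (by positivity)]
    push_cast
    rfl
  have hs0 : ((m : ℂ) + 2) ≠ 0 := by exact_mod_cast (by omega : m + 2 ≠ 0)
  have hinner : ∀ x y : Fin m → ℤˣ,
      star (fun i => ((extendSign x i : ℤ) : ℂ) / (√(m + 2 : ℝ) : ℝ)) ⬝ᵥ
        (fun i => ((extendSign y i : ℤ) : ℂ) / (√(m + 2 : ℝ) : ℝ)) =
      (signInner (extendSign x) (extendSign y) : ℤ) / (m + 2) := by
    intro x y
    simp only [dotProduct, Pi.star_apply, star_div₀, RCLike.star_def, Complex.conj_ofReal,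
      map_intCast, div_mul_div_comm, hs, ← Finset.sum_div, signInner, Int.cast_sum, Int.cast_mul]
  refine graphA_le_idealQuantumA_two_pow (signGraph m)
    (fun x i => ((extendSign x i : ℤ) : ℂ) / (√(m + 2 : ℝ) : ℝ)) (fun x => ?_) (fun x y h => ?_)
    (by rwa [Fintype.card_option, Fintype.card_option, Fintype.card_fin])
  · refine (hinner x x).trans ?_
    rw [signInner_self]
    simp [add_assoc, one_add_one_eq_two, hs0]
  · refine (hinner x y).trans ?_
    have : signInner (extendSign x) (extendSign y) = 0 := by
      by_contra h0
      exact h (or_iff_not_imp_left.2 fun hxy => ⟨hxy, h0⟩)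
    simp [this]

end SignGraph

/-! ### Exponential against polynomial growth -/

theorem not_exists_extension_fractionalCliqueCover :
    ¬ ∃ F ∈ asymptoticSpectrum semiringA,
      ∀ G : GraphClass, (F (graphA G) : ℝ) = fractionalCliqueCover G := by
  rintro ⟨F, hF, hFG⟩
  have hF : Monotone F := hF
  -- With `F(𝒬_2) < 2^a`, the bound `F(𝒬_2)^k ≤ (2^k)^a` is polynomial of degree `a` in the rounded
  -- dimension `2^k`.
  obtain ⟨a, ha⟩ := pow_unbounded_of_one_lt (F (idealQuantumA 2) : ℝ) one_lt_two
  have bound : ∀ p : ℕ, p.Prime → p ≠ 2 → (27 / 16 : ℝ) ^ p ≤ 4 * 8 ^ a * (p : ℝ) ^ a := by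
    intro p hp h2
    have hp2 := hp.two_le
    obtain ⟨m, hm⟩ : ∃ m, m + 2 = 4 * p := ⟨4 * p - 2, by omega⟩
    have hk : 4 * p ≤ 2 ^ Nat.clog 2 (4 * p) := Nat.le_pow_clog one_lt_two _
    -- Rounding `4p` up to a power of two at most doubles it.
    have hk' : 2 ^ Nat.clog 2 (4 * p) ≤ 8 * p := by
      have := Nat.pow_pred_clog_lt_self one_lt_two (x := 4 * p) (by omega)
      have hpos := Nat.clog_pos one_lt_two (n := 4 * p) (by omega)
      have e : 2 ^ Nat.clog 2 (4 * p) = 2 * 2 ^ (Nat.clog 2 (4 * p)).pred := by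
        rw [← pow_succ', Nat.pred_eq_sub_one, Nat.sub_add_cancel hpos]
      omega
    generalize Nat.clog 2 (4 * p) = k at hk hk'
    have h3 := hF (graphA_signGraph_le (hm ▸ hk))
    rw [map_pow] at h3
    have h4 : fractionalCliqueCover (Quotient.mk _ (signGraph m)) ≤
        (F (idealQuantumA 2) : ℝ) ^ k := by
      refine (hFG _).symm.le.trans ?_
      exact_mod_cast h3
    have h5 : (F (idealQuantumA 2) : ℝ) ^ k ≤ (8 * p) ^ a := by
      calc (F (idealQuantumA 2) : ℝ) ^ k ≤ (2 ^ a) ^ k :=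
            pow_le_pow_left₀ (NNReal.coe_nonneg _) ha.le k
        _ = (2 ^ k) ^ a := by rw [← pow_mul, ← pow_mul, mul_comm]
        _ ≤ (8 * p) ^ a := pow_le_pow_left₀ (by positivity) (by exact_mod_cast hk') a
    have h6 := fractionalCliqueCover_signGraph hp h2 hm
    rw [mul_pow] at h5
    linarith
  have hlim := tendsto_pow_const_div_const_pow_of_one_lt a (r := (27 / 16 : ℝ)) (by norm_num)
  obtain ⟨N, hN⟩ := Filter.eventually_atTop.1
    (hlim.eventually_lt_const (show (0 : ℝ) < 1 / (4 * 8 ^ a) by positivity))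
  -- The 3 excludes the prime 2, for which the clique cover bound is not available.
  obtain ⟨p, hpN, hp⟩ := Nat.exists_infinite_primes (max N 3)
  have h1 := hN p ((le_max_left _ _).trans hpN)
  have h3 : 3 ≤ p := (le_max_right _ _).trans hpN
  rw [div_lt_div_iff₀ (by positivity) (by positivity)] at h1
  have := bound p hp (by omega)
  linarith

theorem mainTheorem3 :
    (¬ ∃ F ∈ asymptoticSpectrum semiringA,
      ∀ G : GraphClass, (F (graphA G) : ℝ) = fractionalCliqueCover G) ∧
    ∀ α : ℝ, ¬ IsAdmissibleExponent fractionalCliqueCover α := by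
  refine ⟨not_exists_extension_fractionalCliqueCover, ?_⟩
  rintro α ⟨-, F, hF, h⟩
  refine not_exists_extension_fractionalCliqueCover ⟨F, hF, fun G => ?_⟩
  -- The single summand `d = 1` already gives an extension, since `𝒬_1 = 1` and `1^α = 1`.
  simpa [idealQuantumA_one] using h 1 fun _ => G
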